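/- The Game of Cycles is played on a simple connected plane graph (the gameboard). Player 1 and Player 2 alternately direct a not yet directed edge, Player 1 moving first; a player must move if a legal move exists, and a move is legal if it creates neither a sink nor a source (a vertex all of whose incident edges are directed inwards, respectively outwards). A cycle cell is a chordless cycle of the graph that bounds a bounded region of the drawing and all of whose edges are directed in the same sense of rotation. The winner is the player who first creates a cycle cell, or, if no cycle cell is created, the player who makes the last available move. For $j,k\ge 2$ the $j$-$2$-$k$ board consists of three paths with $j$, $2$ and $k$ edges that join the same two vertices and are otherwise disjoint, drawn with the path of $2$ edges between the other two; so the cycles that can become cycle cells are the two polygons, with $j+2$ and $k+2$ edges, which share the path of $2$ edges. Theorem. Let $j,k\ge 4$. In the Game of Cycles on the $j$-$2$-$k$ board, Player 1 has a winning strategy if $j+k$ is odd, and Player 2 has a winning strategy if $j+k$ is even. -/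

import Mathlib

/-! ## The Game of Cycles -/

namespace GameOfCycles

/-- A chordless cycle of a simple graph: at least three distinct vertices in cyclic order, two of
which are adjacent exactly when they are consecutive. -/
structure ChordlessCycle {V : Type} (G : SimpleGraph V) where
  length : ℕ
  three_le : 3 ≤ length
  vert : Fin length → V
  injective : Function.Injective vert
  adj_iff : ∀ a b : Fin length, G.Adj (vert a) (vert b) ↔
    (b.val = (a.val + 1) % length ∨ a.val = (b.val + 1) % length)

/-- The successor of an index in the cyclic order. -/
def ChordlessCycle.next {V : Type} {G : SimpleGraph V} (c : ChordlessCycle G)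
    (a : Fin c.length) : Fin c.length :=
  ⟨(a.val + 1) % c.length, Nat.mod_lt _ (lt_of_lt_of_le (by decide) c.three_le)⟩

/-- A gameboard: a simple graph, together with its cells, that is, the chordless cycles that
bound the (bounded) regions of its drawing in the plane. -/
structure Board (V : Type) where
  graph : SimpleGraph V
  cells : Set (ChordlessCycle graph)

/-- A position: the set of the arrows drawn so far; the pair `(a, b)` is the arrow `a → b`. -/
abbrev Position (V : Type) : Type := Set (V × V)

/-- All edges incident to `v` (and there is one) are directed towards `v`. -/
def IsSink {V : Type} (G : SimpleGraph V) (P : Position V) (v : V) : Prop :=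
  (∃ w, G.Adj v w) ∧ ∀ w, G.Adj v w → (w, v) ∈ P

/-- All edges incident to `v` (and there is one) are directed away from `v`. -/
def IsSource {V : Type} (G : SimpleGraph V) (P : Position V) (v : V) : Prop :=
  (∃ w, G.Adj v w) ∧ ∀ w, G.Adj v w → (v, w) ∈ P

/-- In position `P` the arrow `m` may be drawn: it directs a hitherto undirected edge and leaves
the board without sinks and sources. -/
def IsLegal {V : Type} (G : SimpleGraph V) (P : Position V) (m : V × V) : Prop :=
  G.Adj m.1 m.2 ∧ m ∉ P ∧ m.swap ∉ P ∧
    ∀ v, ¬ IsSink G (insert m P) v ∧ ¬ IsSource G (insert m P) v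

/-- All edges of the cycle are directed, in the same sense of rotation. -/
def ChordlessCycle.IsDirected {V : Type} {G : SimpleGraph V} (c : ChordlessCycle G)
    (P : Position V) : Prop :=
  (∀ a, (c.vert a, c.vert (c.next a)) ∈ P) ∨ (∀ a, (c.vert (c.next a), c.vert a) ∈ P)

/-- Some cell of the board is a cycle cell. -/
def Board.HasCycleCell {V : Type} (B : Board V) (P : Position V) : Prop :=
  ∃ c ∈ B.cells, c.IsDirected P

/-- The position reached after a list of moves. -/
def position {V : Type} (h : List (V × V)) : Position V := {m | m ∈ h}

/-- The (possibly unfinished) plays of the game, as lists of moves, the most recent move first: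
the players draw legal arrows in turn, and nobody moves once there is a cycle cell. -/
inductive Board.IsPlay {V : Type} (B : Board V) : List (V × V) → Prop
  | nil : Board.IsPlay B []
  | cons {h : List (V × V)} {m : V × V} : Board.IsPlay B h → ¬ B.HasCycleCell (position h) →
      IsLegal B.graph (position h) m → Board.IsPlay B (m :: h)

/-- The play is over: there is a cycle cell, or no legal move is left. -/
def Board.IsOver {V : Type} (B : Board V) (h : List (V × V)) : Prop :=
  B.HasCycleCell (position h) ∨ ∀ m, ¬ IsLegal B.graph (position h) m

inductive Player : Type
  | one
  | two

/-- Player 1 makes the 1st, 3rd, 5th, … move. -/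
def toMove {V : Type} (h : List (V × V)) : Player :=
  if h.length % 2 = 0 then Player.one else Player.two

/-- The player who made the last move. This is the winner of a play that is over, since that move
created a cycle cell or was the last available one. -/
def lastMover {V : Type} (h : List (V × V)) : Player :=
  if h.length % 2 = 1 then Player.one else Player.two

/-- In the play `h`, player `p` has always moved as the strategy `σ` prescribes. -/
def Follows {V : Type} (σ : List (V × V) → V × V) (p : Player) (h : List (V × V)) : Prop :=
  ∀ m h', (m :: h') <:+ h → toMove h' = p → m = σ h'

/-- Player `p` has a strategy (prescribing a move from the play so far) which always yields a legal
move when it is the turn of `p`, and under which every finished play is won by `p`. -/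
def Board.HasWinningStrategy {V : Type} (B : Board V) (p : Player) : Prop :=
  ∃ σ : List (V × V) → V × V, ∀ h, B.IsPlay h → Follows σ p h →
    (¬ B.IsOver h → toMove h = p → IsLegal B.graph (position h) (σ h)) ∧
    (B.IsOver h → lastMover h = p)

/-! ## The `j`-2-`k` board: three paths between two vertices -/

inductive Strand : Type
  | upper
  | inner
  | lower

/-- The numbers of edges of the three paths. -/
def len (j k : ℕ) : Strand → ℕ
  | Strand.upper => j
  | Strand.inner => 2
  | Strand.lower => k

/-- The two common ends of the three paths, and the `i`-th interior vertex (counted from the left)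
of each path, where `0 < i < len j k s`. -/
inductive Vertex (j k : ℕ) : Type
  | left
  | right
  | mid (s : Strand) (i : ℕ) (pos : 0 < i) (lt : i < len j k s)

/-- The `i`-th vertex of a path, for `0 ≤ i ≤ len j k s`. -/
def vertexAt (j k : ℕ) (s : Strand) (i : ℕ) : Vertex j k :=
  if h0 : 0 < i then
    if h1 : i < len j k s then Vertex.mid s i h0 h1 else Vertex.right
  else Vertex.left

theorem vertexAt_eq_iff {j k : ℕ} (hj : 2 ≤ j) (hk : 2 ≤ k) (s t : Strand) (a b : ℕ)
    (ha : a ≤ len j k s) (hb : b ≤ len j k t) :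
    vertexAt j k s a = vertexAt j k t b ↔
      (a = 0 ∧ b = 0) ∨ (a = len j k s ∧ b = len j k t) ∨ (s = t ∧ a = b) := by
  have hs : 2 ≤ len j k s := by cases s <;> simp [len, hj, hk]
  have ht : 2 ≤ len j k t := by cases t <;> simp [len, hj, hk]
  unfold vertexAt
  split_ifs <;> simp <;> grind

/-- Consecutive vertices of each of the three paths are adjacent. -/
def graph (j k : ℕ) (hj : 2 ≤ j) (hk : 2 ≤ k) : SimpleGraph (Vertex j k) where
  Adj v w := ∃ s i, i < len j k s ∧
    ((v = vertexAt j k s i ∧ w = vertexAt j k s (i + 1)) ∨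
      (w = vertexAt j k s i ∧ v = vertexAt j k s (i + 1)))
  symm := ⟨by
    rintro v w ⟨s, i, hi, h⟩
    exact ⟨s, i, hi, h.symm⟩⟩
  loopless := ⟨by
    rintro v ⟨s, i, hi, ⟨h1, h2⟩ | ⟨h1, h2⟩⟩ <;>
    · have h := (vertexAt_eq_iff hj hk s s i (i + 1) (by omega) (by omega)).1 (h1.symm.trans h2)
      have hs : 2 ≤ len j k s := by cases s <;> simp [len, hj, hk]
      omega⟩

theorem graph_adj_iff {j k : ℕ} (hj : 2 ≤ j) (hk : 2 ≤ k) (s t : Strand) (a b : ℕ)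
    (ha : a ≤ len j k s) (hb : b ≤ len j k t) :
    (graph j k hj hk).Adj (vertexAt j k s a) (vertexAt j k t b) ↔
      (s = t ∧ (b = a + 1 ∨ a = b + 1)) ∨
      (a = 0 ∧ b = 1) ∨ (a = 1 ∧ b = 0) ∨
      (a = len j k s ∧ b + 1 = len j k t) ∨ (a + 1 = len j k s ∧ b = len j k t) := by
  have hs : 2 ≤ len j k s := by cases s <;> simp [len, hj, hk]
  have ht : 2 ≤ len j k t := by cases t <;> simp [len, hj, hk]
  constructor
  · rintro ⟨r, i, hi, h⟩
    have hr : 2 ≤ len j k r := by cases r <;> simp [len, hj, hk]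
    rw [vertexAt_eq_iff hj hk s r a i ha (by omega), vertexAt_eq_iff hj hk t r b i hb (by omega),
      vertexAt_eq_iff hj hk s r a (i + 1) ha (by omega),
      vertexAt_eq_iff hj hk t r b (i + 1) hb (by omega)] at h
    grind
  · intro h
    have key : ∀ r i, i < len j k r →
        ((vertexAt j k s a = vertexAt j k r i ∧ vertexAt j k t b = vertexAt j k r (i + 1)) ∨
          (vertexAt j k t b = vertexAt j k r i ∧ vertexAt j k s a = vertexAt j k r (i + 1))) →
        (graph j k hj hk).Adj (vertexAt j k s a) (vertexAt j k t b) :=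
      fun r i hi h => ⟨r, i, hi, h⟩
    have e := fun (r : Strand) (i : ℕ) (hi : i ≤ len j k r) =>
      And.intro (vertexAt_eq_iff hj hk s r a i ha hi) (vertexAt_eq_iff hj hk t r b i hb hi)
    rcases h with ⟨rfl, rfl | rfl⟩ | ⟨rfl, rfl⟩ | ⟨rfl, rfl⟩ | ⟨h1, h2⟩ | ⟨h1, h2⟩
    · exact key s a (by omega) (Or.inl ⟨rfl, rfl⟩)
    · exact key s b (by omega) (Or.inr ⟨rfl, rfl⟩)
    · exact key t 0 (by omega) (by grind)
    · exact key s 0 (by omega) (by grind)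
    · exact key t b (by omega) (by grind)
    · exact key s a (by omega) (by grind)

/-- The polygon made of the paths `s` and `t`: along `s` from left to right and back along `t`. -/
def polygon (j k : ℕ) (hj : 2 ≤ j) (hk : 2 ≤ k) (s t : Strand) (hst : s ≠ t) :
    ChordlessCycle (graph j k hj hk) where
  length := len j k s + len j k t
  three_le := by
    have hs : 2 ≤ len j k s := by cases s <;> simp [len, hj, hk]
    have ht : 2 ≤ len j k t := by cases t <;> simp [len, hj, hk]
    omega
  vert i := if i.val ≤ len j k s then vertexAt j k s i.val
    else vertexAt j k t (len j k s + len j k t - i.val)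
  injective := by
    rintro ⟨a, ha⟩ ⟨b, hb⟩ h
    have hs : 2 ≤ len j k s := by cases s <;> simp [len, hj, hk]
    have ht : 2 ≤ len j k t := by cases t <;> simp [len, hj, hk]
    simp only [Fin.mk.injEq]
    dsimp only at h
    split_ifs at h <;> rw [vertexAt_eq_iff hj hk _ _ _ _ (by omega) (by omega)] at h <;>
      simp only [hst, hst.symm, eq_self, false_and, true_and, or_false] at h <;> omega
  adj_iff := by
    rintro ⟨a, ha⟩ ⟨b, hb⟩
    have hs : 2 ≤ len j k s := by cases s <;> simp [len, hj, hk]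
    have ht : 2 ≤ len j k t := by cases t <;> simp [len, hj, hk]
    have hm : ∀ x, x < len j k s + len j k t → (x + 1) % (len j k s + len j k t) =
        if x + 1 = len j k s + len j k t then 0 else x + 1 := by
      intro x hx
      split_ifs with h
      · rw [h, Nat.mod_self]
      · exact Nat.mod_eq_of_lt (by omega)
    dsimp only
    rw [hm a ha, hm b hb]
    have hts : t ≠ s := hst.symm
    split_ifs <;> rw [graph_adj_iff hj hk _ _ _ _ (by omega) (by omega)] <;>
      simp only [hst, hts, eq_self, false_and, true_and, false_or] <;> omega

/-- The `j`-2-`k` board, drawn with the path of length 2 between the two others: its cells are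
the polygon with `j + 2` edges above and the polygon with `k + 2` edges below that path. -/
def board (j k : ℕ) (hj : 2 ≤ j) (hk : 2 ≤ k) : Board (Vertex j k) where
  graph := graph j k hj hk
  cells := {polygon j k hj hk Strand.upper Strand.inner (by simp),
    polygon j k hj hk Strand.inner Strand.lower (by simp)}

end GameOfCycles

namespace GameOfCycles

/-! ### Signings: edge `i` of path `s` has sign `1` (`-1`) if it is directed to the right (left),
and `0` if it is undirected. -/

/-! Record each edge of a path by a sign: `1` to the right, `-1` to the left, `0` if undirected. No
sinks and no sources then means that directed neighbours within a path agree and that the three end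
edges at a junction never carry the same nonzero sign.

The winning player fixes a sign `e` carried by some edge of the inner path and wants an end edge of
sign `e` on an outer path at each junction. Suppose this is achieved and no move is left. Along a
path the sign flips exactly at undirected edges, so the parity of their number is read off from the
signs at its two ends (`Balanced.neg_one_pow_zeros`). At each junction these end signs are `e`, `e`,
`-e` in some order (`Balanced.endSign_mul`), so the product over both junctions is `1` and the
number of undirected edges is even (`Balanced.even_zeros`). Since there are `j + 2 + k` edges, this
fixes the parity of the number of moves, hence the last mover.

Cycle cells must be kept from interfering. After each of his moves the winning player leaves no
completion in one move, and he completes a cell himself when the opponent allows it. A cell needs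
`e` on the whole inner path and `-e` on a whole outer path, so drawing `e` on an outer path never
helps to build one. If both junctions are settled, a harmless move exists by the same parity count
(`Balanced.exists_quiet`). `Controlled` is the resulting invariant and `Controlled.respond` restores
it after every move of the opponent. The rest translates signings into the actual game. -/

instance : DecidableEq Strand := fun a b => by
  cases a <;> cases b <;> first | exact isTrue rfl | exact isFalse (by simp)

theorem two_le_len {j k : ℕ} (hj : 2 ≤ j) (hk : 2 ≤ k) (s : Strand) : 2 ≤ len j k s := by
  cases s <;> simp [len, hj, hk]

theorem four_le_len {j k : ℕ} (hj : 4 ≤ j) (hk : 4 ≤ k) {s : Strand} (hs : s ≠ Strand.inner) :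
    4 ≤ len j k s := by
  cases s <;> simp_all [len]

/-- Give edge `i` of path `s` the sign `f`. -/
def draw (x : Strand → ℕ → ℤ) (s : Strand) (i : ℕ) (f : ℤ) : Strand → ℕ → ℤ :=
  fun t l => if t = s ∧ l = i then f else x t l

/-- The edge of path `s` at the right (`b = true`) or left common end of the paths. -/
def endEdge (j k : ℕ) (b : Bool) (s : Strand) : ℕ := if b then len j k s - 1 else 0

/-- The neighbour in path `s` of its edge at the right or left common end. -/
def nextEdge (j k : ℕ) (b : Bool) (s : Strand) : ℕ := if b then len j k s - 2 else 1

/-- There are neither sinks nor sources. -/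
structure Balanced (j k : ℕ) (x : Strand → ℕ → ℤ) : Prop where
  sign : ∀ s i, x s i = 0 ∨ x s i = 1 ∨ x s i = -1
  path : ∀ s i, i + 1 < len j k s → x s i = 0 ∨ x s (i + 1) = 0 ∨ x s i = x s (i + 1)
  junction : ∀ b f, f ≠ 0 → ∃ t, x t (endEdge j k b t) ≠ f

theorem Balanced.mono {j k : ℕ} {x y : Strand → ℕ → ℤ} (hy : Balanced j k y)
    (h : ∀ s i, x s i = 0 ∨ x s i = y s i) : Balanced j k x where
  sign s i := by
    have := hy.sign s i
    have := h s i
    grind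
  path s i hi := by
    have := hy.path s i hi
    have := h s i
    have := h s (i + 1)
    grind
  junction b f hf := by
    obtain ⟨t, ht⟩ := hy.junction b f hf
    refine ⟨t, ?_⟩
    rcases h t (endEdge j k b t) with h | h <;> rw [h]
    · exact hf.symm
    · exact ht

/-- Edge `i` of path `s` may be given the sign `f`. -/
structure CanDraw (j k : ℕ) (x : Strand → ℕ → ℤ) (s : Strand) (i : ℕ) (f : ℤ) : Prop where
  lt : i < len j k s
  ne : f ≠ 0
  zero : x s i = 0
  balanced : Balanced j k (draw x s i f)

/-- Legality is monotone: erasing an arrow creates no sink or source. Thus a move available later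
was already available. -/
theorem CanDraw.of_draw {j k : ℕ} {x : Strand → ℕ → ℤ} {s t : Strand} {i l : ℕ} {f g : ℤ}
    (h : CanDraw j k (draw x s i f) t l g) (hf : f ≠ 0) (hx : x s i = 0) :
    CanDraw j k x t l g := by
  have hz := h.zero
  have hne : ¬ (t = s ∧ l = i) := by
    intro hh
    simp [draw, hh, hf] at hz
  refine ⟨h.lt, h.ne, by simpa [draw, hne] using hz, h.balanced.mono fun r n => ?_⟩
  unfold draw
  grind

theorem Balanced.canDraw_middle {j k : ℕ}
    {x : Strand → ℕ → ℤ} (hx : Balanced j k x)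
    {s : Strand} {i : ℕ} {f : ℤ} (hf : f = 1 ∨ f = -1) (h0 : 0 < i) (h1 : i + 1 < len j k s)
    (hz : x s i = 0) (hp : x s (i - 1) ≠ -f) (hn : x s (i + 1) ≠ -f) : CanDraw j k x s i f := by
  refine ⟨by omega, by omega, hz, ⟨fun r n => ?_, fun r n hn => ?_, fun b g hg => ?_⟩⟩
  · have := hx.sign r n
    unfold draw
    grind
  · have := hx.path r n hn
    have := hx.sign s (i - 1)
    have := hx.sign s (i + 1)
    unfold draw
    grind
  · obtain ⟨t, ht⟩ := hx.junction b g hg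
    refine ⟨t, ?_⟩
    unfold draw
    rw [if_neg]
    · exact ht
    · unfold endEdge
      grind

theorem Balanced.canDraw_end {j k : ℕ} (hj : 2 ≤ j) (hk : 2 ≤ k)
    {x : Strand → ℕ → ℤ} (hx : Balanced j k x) {b : Bool}
    {s : Strand} {f : ℤ} (hf : f = 1 ∨ f = -1) (hz : x s (endEdge j k b s) = 0)
    (hn : x s (nextEdge j k b s) ≠ -f) (ht : ∃ t, t ≠ s ∧ x t (endEdge j k b t) ≠ f) :
    CanDraw j k x s (endEdge j k b s) f := by
  have h2 := two_le_len hj hk s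
  refine ⟨?_, by omega, hz, ⟨fun r n => ?_, fun r n hn => ?_, fun c g hg => ?_⟩⟩
  · unfold endEdge
    grind
  · have := hx.sign r n
    unfold draw
    grind
  · have := hx.path r n hn
    have := hx.sign s (nextEdge j k b s)
    unfold draw
    unfold nextEdge endEdge at *
    cases b <;> grind
  · by_cases hbc : c = b
    · subst hbc
      obtain ⟨t, hts, ht⟩ := ht
      by_cases hgf : g = f
      · exact ⟨t, by simpa [draw, hts, hgf] using ht⟩
      · exact ⟨s, by simpa [draw] using Ne.symm hgf⟩
    · obtain ⟨t, ht⟩ := hx.junction c g hg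
      refine ⟨t, ?_⟩
      unfold draw
      rw [if_neg]
      · exact ht
      · unfold endEdge
        grind

/-! ### Counting undirected edges -/

/-- The number of undirected edges of path `s`. -/
def zeros (j k : ℕ) (x : Strand → ℕ → ℤ) (s : Strand) : ℕ :=
  ((Finset.range (len j k s)).filter (fun i => x s i = 0)).card

theorem CanDraw.zeros_draw {j k : ℕ} {x : Strand → ℕ → ℤ} {s : Strand} {i : ℕ} {f : ℤ}
    (h : CanDraw j k x s i f) (t : Strand) :
    zeros j k (draw x s i f) t + (if t = s then 1 else 0) = zeros j k x t := by
  unfold zeros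
  split_ifs with hts
  · subst hts
    have : (Finset.range (len j k t)).filter (fun l => draw x t i f t l = 0) =
        ((Finset.range (len j k t)).filter (fun l => x t l = 0)).erase i := by
      ext l
      have := h.ne
      simp only [Finset.mem_filter, Finset.mem_erase, draw]
      grind
    rw [this, Finset.card_erase_add_one]
    simp [h.lt, h.zero]
  · simp [draw, hts]

theorem zeros_eq_zero {j k : ℕ} {x : Strand → ℕ → ℤ} {s : Strand} (h : ∀ i < len j k s, x s i ≠ 0) :
    zeros j k x s = 0 := by
  simp only [zeros, Finset.card_eq_zero, Finset.filter_eq_empty_iff, Finset.mem_range]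
  exact fun i hi => h i hi

/-- Adjacent nonzero terms agree and every zero lies between opposite nonzero terms, so each zero
contributes exactly one change of sign. -/
theorem neg_one_pow_card_zeros {y : ℕ → ℤ} {N : ℕ} (hs : ∀ i, y i = 0 ∨ y i = 1 ∨ y i = -1)
    (h0 : y 0 ≠ 0) (hadj : ∀ i < N, y i = 0 ∨ y (i + 1) = 0 ∨ y i = y (i + 1))
    (hz : ∀ i, i + 1 < N → y (i + 1) = 0 → y (i + 2) ≠ 0 ∧ y i = -y (i + 2)) (i : ℕ) :
    i ≤ N → y i ≠ 0 →
      (-1 : ℤ) ^ ((Finset.range i).filter (fun l => y l = 0)).card = y 0 * y i := by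
  induction i using Nat.strong_induction_on with
  | _ i ih =>
    intro hi hyi
    match i with
    | 0 =>
      have := hs 0
      simp
      grind
    | 1 =>
      have := hadj 0 (by omega)
      have := hs 0
      simp [Finset.range_one, Finset.filter_singleton, h0]
      grind
    | n + 2 =>
      by_cases hn : y (n + 1) = 0
      · obtain ⟨-, h1⟩ := hz n (by omega) hn
        have hyn : y n ≠ 0 := by rw [h1]; simpa using hyi
        have := ih n (by omega) (by omega) hyn
        rw [Finset.range_add_one, Finset.filter_insert, if_pos hn, Finset.card_insert_of_notMem
          (by simp), Finset.range_add_one, Finset.filter_insert, if_neg hyn, pow_succ, this, h1]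
        ring
      · have := ih (n + 1) (by omega) (by omega) hn
        rw [Finset.range_add_one, Finset.filter_insert, if_neg hn, this]
        have := hadj (n + 1) (by omega)
        grind

/-- The sign with which path `s` starts at one of its ends, where an undirected last edge is
extended by an edge opposite to the second one. -/
def endSign (j k : ℕ) (x : Strand → ℕ → ℤ) (b : Bool) (s : Strand) : ℤ :=
  if x s (endEdge j k b s) = 0 then -x s (nextEdge j k b s) else x s (endEdge j k b s)

/-- On a path without legal moves every undirected interior edge has opposite neighbours. The
virtual edges of `endSign` make this true at the ends as well, so the sign-change count applies to
the extended path. -/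
theorem Balanced.neg_one_pow_zeros {j k : ℕ} (hj : 2 ≤ j) (hk : 2 ≤ k)
    {x : Strand → ℕ → ℤ} (hx : Balanced j k x) {s : Strand} (hno : ∀ i f, ¬ CanDraw j k x s i f)
    (he : ∀ b, endSign j k x b s ≠ 0) :
    (-1 : ℤ) ^ zeros j k x s = endSign j k x false s * endSign j k x true s := by
  have h2 := two_le_len hj hk s
  -- At an interior edge a direction is blocked only by a neighbour of the opposite sign. As both
  -- directions are blocked, both signs occur among the two neighbours.
  have hm : ∀ i, 0 < i → i + 1 < len j k s → x s i = 0 →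
      x s (i + 1) ≠ 0 ∧ x s (i - 1) = -x s (i + 1) := by
    intro i h0 h1 hz
    have ha : x s (i - 1) = -1 ∨ x s (i + 1) = -1 := by
      by_contra! hh
      exact hno i 1 (hx.canDraw_middle (by simp) h0 h1 hz hh.1 hh.2)
    have hb : x s (i - 1) = 1 ∨ x s (i + 1) = 1 := by
      by_contra! hh
      exact hno i (-1) (hx.canDraw_middle (by simp) h0 h1 hz (by simpa using hh.1)
        (by simpa using hh.2))
    omega
  obtain ⟨n, hn⟩ : ∃ n, len j k s = n + 2 := ⟨len j k s - 2, by omega⟩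
  set a := endSign j k x false s with ha
  set c := endSign j k x true s with hc
  have hsa : a = 0 ∨ a = 1 ∨ a = -1 := by
    have := hx.sign s (endEdge j k false s)
    have := hx.sign s (nextEdge j k false s)
    rw [ha, endSign]
    split_ifs <;> omega
  have hsc : c = 0 ∨ c = 1 ∨ c = -1 := by
    have := hx.sign s (endEdge j k true s)
    have := hx.sign s (nextEdge j k true s)
    rw [hc, endSign]
    split_ifs <;> omega
  have hae := he false
  have hce := he true
  rw [← ha] at hae
  rw [← hc] at hce
  simp only [endSign, endEdge, nextEdge, hn] at ha hc
  simp only [Bool.false_eq_true, if_false, if_true] at ha hc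
  rw [show n + 2 - 1 = n + 1 by omega, show n + 2 - 2 = n by omega] at hc
  -- The path shifted by one, with the end signs placed at `0` and `n + 3`; the added terms are
  -- nonzero, so the number of zeros is unchanged.
  let y : ℕ → ℤ := fun i => if i = 0 then a else if i = n + 3 then c else x s (i - 1)
  have y0 : y 0 = a := by simp [y]
  have yl : y (n + 3) = c := by simp [y]
  have ym : ∀ i, i < n + 2 → y (i + 1) = x s i := by
    intro i hi
    simp [y, show i ≠ n + 2 by omega]
  have key := neg_one_pow_card_zeros (y := y) (N := n + 3) ?_ ?_ ?_ ?_ (n + 3) le_rfl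
    (by rw [yl]; exact hce)
  · rw [y0, yl] at key
    rw [← key]
    congr 1
    rw [zeros, hn, Finset.range_eq_Ico, Finset.range_eq_Ico]
    symm
    refine Finset.card_bij' (fun i _ => i - 1) (fun i _ => i + 1) ?_ ?_ ?_ ?_
    · intro i hi
      simp only [Finset.mem_filter, Finset.mem_Ico] at hi ⊢
      have : i ≠ 0 := by
        rintro rfl
        exact hae (y0 ▸ hi.2)
      have := ym (i - 1) (by omega)
      rw [Nat.sub_add_cancel (by omega)] at this
      exact ⟨by omega, this ▸ hi.2⟩
    · intro i hi
      simp only [Finset.mem_filter, Finset.mem_Ico] at hi ⊢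
      exact ⟨by omega, by rw [ym i (by omega)]; exact hi.2⟩
    · intro i hi
      simp only [Finset.mem_filter, Finset.mem_Ico] at hi
      have : i ≠ 0 := by
        rintro rfl
        exact hae (y0 ▸ hi.2)
      omega
    · intro i hi
      simp
  · intro i
    simp only [y]
    split_ifs
    · exact hsa
    · exact hsc
    · exact hx.sign s _
  · rw [y0]; exact hae
  · intro i hi
    rcases Nat.eq_zero_or_pos i with rfl | h0
    · rw [y0, ym 0 (by omega)]
      grind
    · obtain ⟨l, rfl⟩ : ∃ l, i = l + 1 := ⟨i - 1, by omega⟩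
      rw [ym l (by omega)]
      by_cases hl : l = n + 1
      · subst hl
        rw [yl]
        grind
      · rw [ym (l + 1) (by omega)]
        exact hx.path s l (by omega)
  · intro i hi
    rw [ym i (by omega)]
    intro hz
    rcases Nat.eq_zero_or_pos i with rfl | h0
    · rw [y0, ym 1 (by omega)]
      grind
    · obtain ⟨l, rfl⟩ : ∃ l, i = l + 1 := ⟨i - 1, by omega⟩
      rw [ym l (by omega)]
      by_cases hl : l = n
      · subst hl
        rw [yl]
        grind
      · rw [ym (l + 1 + 1) (by omega)]
        simpa using hm (l + 1) (by omega) (by omega) hz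

/-! ### The invariant -/

/-- An end edge of the upper or lower path at the given junction has sign `e`. -/
def Settled (j k : ℕ) (e : ℤ) (b : Bool) (x : Strand → ℕ → ℤ) : Prop :=
  ∃ t ≠ Strand.inner, x t (endEdge j k b t) = e

/-- The junction is settled, or the sign `-e` does not occur near it. -/
def Safe (j k : ℕ) (e : ℤ) (b : Bool) (x : Strand → ℕ → ℤ) : Prop :=
  Settled j k e b x ∨
    ∀ t ≠ Strand.inner, x t (endEdge j k b t) ≠ -e ∧ x t (nextEdge j k b t) ≠ -e

/-- Some cell is a cycle cell. -/
def HasCell (j k : ℕ) (x : Strand → ℕ → ℤ) : Prop :=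
  ∃ s ≠ Strand.inner, ∃ e ≠ 0, (∀ i < len j k s, x s i = -e) ∧
    ∀ i < len j k Strand.inner, x Strand.inner i = e

/-- No cycle cell can be created at once. -/
def Quiet (j k : ℕ) (x : Strand → ℕ → ℤ) : Prop :=
  ∀ s i f, CanDraw j k x s i f → ¬ HasCell j k (draw x s i f)

/-- The property that the winning player preserves. -/
structure Controlled (j k : ℕ) (e : ℤ) (x : Strand → ℕ → ℤ) : Prop where
  ne : e ≠ 0
  inner : x Strand.inner 0 = e ∨ x Strand.inner 1 = e
  safe : ∀ b, Safe j k e b x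
  quiet : Quiet j k x

theorem HasCell.not_of_zeros {j k : ℕ} {x : Strand → ℕ → ℤ}
    (h : ∀ s ≠ Strand.inner, 0 < zeros j k x s + zeros j k x Strand.inner) : ¬ HasCell j k x := by
  rintro ⟨s, hs, e, he, h1, h2⟩
  have := h s hs
  rw [zeros_eq_zero (fun i hi => by rw [h1 i hi]; simpa using he),
    zeros_eq_zero (fun i hi => by rw [h2 i hi]; exact he)] at this
  omega

/-- One move directs one edge, so a cell with at least two undirected edges cannot be completed at
once. -/
theorem Quiet.of_zeros {j k : ℕ} {x : Strand → ℕ → ℤ}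
    (h : ∀ s ≠ Strand.inner, 1 < zeros j k x s + zeros j k x Strand.inner) : Quiet j k x := by
  intro t l f hc
  apply HasCell.not_of_zeros
  intro s hs
  have := h s hs
  have h1 := hc.zeros_draw s
  have h2 := hc.zeros_draw Strand.inner
  split_ifs at h1 h2 <;> first | omega | (exfalso; grind)

/-- At a settled junction of a position without legal moves, two of the three signs are `e`. -/
theorem Balanced.endSign_mul {j k : ℕ} (hj : 2 ≤ j) (hk : 2 ≤ k)
    {x : Strand → ℕ → ℤ} (hx : Balanced j k x) (hno : ∀ s i f, ¬ CanDraw j k x s i f) {e : ℤ}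
    (he : e = 1 ∨ e = -1) {b : Bool} (hs : Settled j k e b x)
    (hi : x Strand.inner 0 = e ∨ x Strand.inner 1 = e) :
    (∀ s, endSign j k x b s ≠ 0) ∧ endSign j k x b Strand.upper * endSign j k x b Strand.inner *
      endSign j k x b Strand.lower = -e := by
  have hblock : ∀ s f, (f = 1 ∨ f = -1) → x s (endEdge j k b s) = 0 →
      x s (nextEdge j k b s) = -f ∨ ∀ t, t ≠ s → x t (endEdge j k b t) = f := by
    intro s f hf hz
    by_contra! hh
    exact hno s _ f (hx.canDraw_end hj hk hf hz hh.1 hh.2)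
  have hinner : x Strand.inner (endEdge j k b Strand.inner) = e ∨
      x Strand.inner (nextEdge j k b Strand.inner) = e := by
    cases b <;> simp [endEdge, nextEdge, len] <;> tauto
  -- The inner path has only two edges and one of them is `e`, so the other cannot be `-e`.
  have hib : x Strand.inner (endEdge j k b Strand.inner) ≠ -e := by
    have := hx.path Strand.inner 0 (by simp [len])
    have h1 : endEdge j k b Strand.inner = 0 ∨ endEdge j k b Strand.inner = 1 := by
      cases b <;> simp [endEdge, len]
    rcases h1 with h1 | h1 <;> rw [h1] <;> grind
  have hjn := hx.junction b e (by omega)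
  have hsgn := fun s => hx.sign s (endEdge j k b s)
  have hsgn' := fun s => hx.sign s (nextEdge j k b s)
  have hse : x Strand.upper (endEdge j k b Strand.upper) = e ∨
      x Strand.lower (endEdge j k b Strand.lower) = e := by
    obtain ⟨t, ht, h⟩ := hs
    cases t <;> simp_all
  have hjn' : x Strand.upper (endEdge j k b Strand.upper) ≠ e ∨
      x Strand.inner (endEdge j k b Strand.inner) ≠ e ∨
      x Strand.lower (endEdge j k b Strand.lower) ≠ e := by
    obtain ⟨t, ht⟩ := hjn
    cases t <;> simp_all
  -- Sign `-e` cannot be blocked at the junction, where `e` occurs, so it is blocked by a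
  -- neighbouring edge of sign `e`. That edge does not block `e`, which must therefore be blocked by
  -- two `e`s at the junction.
  have hdir : ∀ s, x s (endEdge j k b s) = 0 →
      (∀ t, t ≠ s → x t (endEdge j k b t) = e) ∧ x s (nextEdge j k b s) = e := by
    intro s hz
    obtain ⟨t, hts, hte⟩ : ∃ t, t ≠ s ∧ x t (endEdge j k b t) = e := by
      obtain ⟨t, -, h⟩ := hs
      refine ⟨t, ?_, h⟩
      rintro rfl
      omega
    have h1 := hblock s e he hz
    have h2 := hblock s (-e) (by omega) hz
    rcases h2 with h2 | h2
    · rcases h1 with h1 | h1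
      · omega
      · exact ⟨h1, by omega⟩
    · have := h2 t hts
      omega
  have hval : ∀ s, endSign j k x b s =
      if x s (endEdge j k b s) = 0 then -e else x s (endEdge j k b s) := by
    intro s
    unfold endSign
    split_ifs with h
    · rw [(hdir s h).2]
    · rfl
  refine ⟨fun s => ?_, ?_⟩
  · rw [hval]
    split_ifs <;> omega
  · have du := hdir Strand.upper
    have di := hdir Strand.inner
    have dl := hdir Strand.lower
    have u1 := fun h => (du h).1 Strand.inner (by simp)
    have u2 := fun h => (du h).1 Strand.lower (by simp)
    have i1 := fun h => (di h).1 Strand.upper (by simp)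
    have i2 := fun h => (di h).1 Strand.lower (by simp)
    have l1 := fun h => (dl h).1 Strand.inner (by simp)
    have l2 := fun h => (dl h).1 Strand.upper (by simp)
    have su := hsgn Strand.upper
    have si := hsgn Strand.inner
    have sl := hsgn Strand.lower
    rw [hval, hval, hval]
    clear hval hdir hsgn hsgn' hblock du di dl hjn hinner hs hno hx
    generalize x Strand.upper (endEdge j k b Strand.upper) = u at *
    generalize x Strand.inner (endEdge j k b Strand.inner) = v at *
    generalize x Strand.lower (endEdge j k b Strand.lower) = w at *
    rcases he with rfl | rfl <;> rcases su with rfl | rfl | rfl <;>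
      rcases si with rfl | rfl | rfl <;> rcases sl with rfl | rfl | rfl <;>
        first | (norm_num; done) | (exfalso; omega)

theorem Balanced.even_zeros {j k : ℕ} (hj : 2 ≤ j) (hk : 2 ≤ k)
    {x : Strand → ℕ → ℤ} (hx : Balanced j k x) (hno : ∀ s i f, ¬ CanDraw j k x s i f) {e : ℤ}
    (he : e = 1 ∨ e = -1) (hs : ∀ b, Settled j k e b x)
    (hi : x Strand.inner 0 = e ∨ x Strand.inner 1 = e) :
    Even (zeros j k x Strand.upper + zeros j k x Strand.inner + zeros j k x Strand.lower) := by
  have h := fun b => hx.endSign_mul hj hk hno he (hs b) hi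
  have hp := fun s => hx.neg_one_pow_zeros hj hk (hno s) (fun b => (h b).1 s)
  rw [← neg_one_pow_eq_one_iff_even (R := ℤ) (by norm_num), pow_add, pow_add, hp, hp, hp]
  have h1 := (h false).2
  have h2 := (h true).2
  calc _ = (endSign j k x false Strand.upper * endSign j k x false Strand.inner *
      endSign j k x false Strand.lower) * (endSign j k x true Strand.upper *
      endSign j k x true Strand.inner * endSign j k x true Strand.lower) := by ring
    _ = 1 := by
      rw [h1, h2]
      rcases he with rfl | rfl <;> norm_num

/-! ### The reply of the winning player -/

theorem CanDraw.draw_eq {j k : ℕ} {x : Strand → ℕ → ℤ} {s t : Strand} {i l : ℕ} {f e : ℤ}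
    (h : CanDraw j k x s i f) (he : e ≠ 0) (hx : x t l = e) : draw x s i f t l = e := by
  have := h.zero
  unfold draw
  grind

theorem Settled.draw {j k : ℕ} {x : Strand → ℕ → ℤ} {s : Strand} {i : ℕ} {f e : ℤ} {b : Bool}
    (hs : Settled j k e b x) (h : CanDraw j k x s i f) (he : e ≠ 0) :
    Settled j k e b (draw x s i f) := by
  obtain ⟨t, ht, hte⟩ := hs
  exact ⟨t, ht, h.draw_eq he hte⟩

theorem Safe.draw {j k : ℕ} {x : Strand → ℕ → ℤ} {s : Strand} {i : ℕ} {e : ℤ} {b : Bool}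
    (hs : Safe j k e b x) (h : CanDraw j k x s i e) : Safe j k e b (draw x s i e) := by
  rcases hs with hs | hs
  · exact Or.inl (hs.draw h h.ne)
  · right
    intro t ht
    have := hs t ht
    have := h.ne
    unfold GameOfCycles.draw
    grind

/-- The inner sign `e` forces the outer path of any cell to be all `-e`, so path `t` is now useless
for a cell. A cell completed on the other outer path could have been completed without the arrow on
`t`. -/
theorem CanDraw.quiet_draw {j k : ℕ} {x : Strand → ℕ → ℤ} {t : Strand} {l : ℕ} {e : ℤ}
    (h : CanDraw j k x t l e) (ht : t ≠ Strand.inner)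
    (hi : x Strand.inner 0 = e ∨ x Strand.inner 1 = e) (hq : Quiet j k x) :
    Quiet j k (draw x t l e) := by
  rintro s i f hc ⟨r, hr, e', he', h1, h2⟩
  have hee : e' = e := by
    rcases hi with hi | hi
    · rw [← h2 0 (by simp [len])]
      exact hc.draw_eq h.ne (h.draw_eq h.ne hi)
    · rw [← h2 1 (by simp [len])]
      exact hc.draw_eq h.ne (h.draw_eq h.ne hi)
  subst hee
  have hrt : r ≠ t := by
    rintro rfl
    have h3 := h1 l h.lt
    rw [hc.draw_eq (e := e') he' (by simp [draw])] at h3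
    omega
  refine hq s i f (hc.of_draw h.ne h.zero) ⟨r, hr, e', he', fun n hn => ?_, fun n hn => ?_⟩
  · rw [← h1 n hn]
    simp [draw, hrt]
  · rw [← h2 n hn]
    simp [draw, ht.symm]

/-- When both junctions are settled and an odd number of edges is undirected, some move allows no
immediate completion of a cell: otherwise exactly two edges of a cell are missing and the third path
allows no move, so that the number of undirected edges is even. -/
theorem Balanced.exists_quiet {j k : ℕ} (hj : 2 ≤ j) (hk : 2 ≤ k)
    {x : Strand → ℕ → ℤ} (hx : Balanced j k x) (hq : Quiet j k x) {e : ℤ}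
    (he : e = 1 ∨ e = -1) (hs : ∀ b, Settled j k e b x)
    (hi : x Strand.inner 0 = e ∨ x Strand.inner 1 = e)
    (hodd : Odd (zeros j k x Strand.upper + zeros j k x Strand.inner + zeros j k x Strand.lower)) :
    ∃ t l g, CanDraw j k x t l g ∧ Quiet j k (draw x t l g) := by
  by_contra! hcon
  have he0 : e ≠ 0 := by omega
  obtain ⟨t, l, g, h⟩ : ∃ t l g, CanDraw j k x t l g := by
    by_contra! hno
    exact (Nat.not_even_iff_odd.2 hodd) (hx.even_zeros hj hk hno he hs hi)
  -- If every move permits a completion, move and completion together fill a cell. Since `x` is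
  -- quiet, both must lie on that cell, which therefore had exactly two undirected edges.
  have threat : ∀ t l g, CanDraw j k x t l g → ∃ r, r ≠ Strand.inner ∧
      (∀ b, x r (endEdge j k b r) ≠ e) ∧ (t = r ∨ t = Strand.inner) ∧
      zeros j k x r + zeros j k x Strand.inner = 2 := by
    intro t l g h
    have hnq := hcon t l g h
    unfold Quiet at hnq
    push Not at hnq
    obtain ⟨s, i, f, hc, r, hr, e', he', h1, h2⟩ := hnq
    have hee : e' = e := by
      rcases hi with hi | hi
      · rw [← h2 0 (by simp [len])]
        exact hc.draw_eq he0 (h.draw_eq he0 hi)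
      · rw [← h2 1 (by simp [len])]
        exact hc.draw_eq he0 (h.draw_eq he0 hi)
    subst hee
    have ht : t = r ∨ t = Strand.inner := by
      by_contra! hh
      refine hq s i f (hc.of_draw h.ne h.zero) ⟨r, hr, e', he', fun n hn => ?_, fun n hn => ?_⟩
      · rw [← h1 n hn]
        simp [draw, hh.1.symm]
      · rw [← h2 n hn]
        simp [draw, hh.2.symm]
    have hsr : s = r ∨ s = Strand.inner := by
      by_contra! hh
      refine hq t l g h ⟨r, hr, e', he', fun n hn => ?_, fun n hn => ?_⟩
      · rw [← h1 n hn]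
        simp [draw, hh.1.symm]
      · rw [← h2 n hn]
        simp [draw, hh.2.symm]
    refine ⟨r, hr, fun b hb => ?_, ht, ?_⟩
    · have h3 := h1 (endEdge j k b r) (by
        have := two_le_len hj hk r
        unfold endEdge
        split_ifs <;> omega)
      rw [hc.draw_eq he0 (h.draw_eq he0 hb)] at h3
      omega
    · have z1 : zeros j k (draw (draw x t l g) s i f) r = 0 :=
        zeros_eq_zero fun i hi => by rw [h1 i hi]; simpa using he'
      have z2 : zeros j k (draw (draw x t l g) s i f) Strand.inner = 0 :=
        zeros_eq_zero fun i hi => by rw [h2 i hi]; exact he'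
      have a1 := h.zeros_draw r
      have a2 := h.zeros_draw Strand.inner
      have b1 := hc.zeros_draw r
      have b2 := hc.zeros_draw Strand.inner
      rw [z1] at b1
      rw [z2] at b2
      have hr' := hr.symm
      rcases ht with rfl | rfl <;> rcases hsr with rfl | rfl <;>
        simp only [hr, hr', if_true, if_false] at a1 a2 b1 b2 <;> omega
  obtain ⟨r, hr, hre, -, hz⟩ := threat t l g h
  -- The threatened path `r` has no end edge of sign `e`, so the other outer path `q` settles both
  -- junctions.
  obtain ⟨q, hq1, hq2, hqe, hsum⟩ : ∃ q, q ≠ Strand.inner ∧ q ≠ r ∧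
      (∀ b, x q (endEdge j k b q) = e) ∧ zeros j k x Strand.upper + zeros j k x Strand.inner +
        zeros j k x Strand.lower = zeros j k x q + 2 := by
    have hset : ∀ q, q ≠ r → q ≠ Strand.inner → ∀ b, x q (endEdge j k b q) = e := by
      intro q hqr hqi b
      obtain ⟨u, hu, hue⟩ := hs b
      have : u ≠ r := by
        rintro rfl
        exact hre b hue
      have : u = q := by
        cases u <;> cases q <;> cases r <;> simp_all
      exact this ▸ hue
    cases r
    · exact ⟨Strand.lower, by simp, by simp, hset _ (by simp) (by simp), by omega⟩
    · exact absurd rfl hr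
    · exact ⟨Strand.upper, by simp, by simp, hset _ (by simp) (by simp), by omega⟩
  -- A move on `q` would be part of a threatened cell using `q`, impossible with ends `e`. So `q` is
  -- blocked and, its end signs being equal, has an even number of undirected edges.
  have hnoq : ∀ i f, ¬ CanDraw j k x q i f := by
    intro i f hc
    obtain ⟨r', hr', hre', hor, -⟩ := threat q i f hc
    rcases hor with rfl | h'
    · exact hre' true (hqe true)
    · exact hq1 h'
  have hend : ∀ b, endSign j k x b q = e := by
    intro b
    unfold endSign
    rw [hqe b, if_neg he0]
  have hp := hx.neg_one_pow_zeros hj hk hnoq (fun b => by rw [hend]; exact he0)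
  rw [hend, hend, show e * e = 1 by rcases he with rfl | rfl <;> norm_num,
    neg_one_pow_eq_one_iff_even (by norm_num)] at hp
  rw [hsum] at hodd
  have : Even (zeros j k x q + 2) := hp.add (by decide)
  exact (Nat.not_even_iff_odd.2 hodd) this

/-- A junction can be settled if, on one path, the sign `-e` does not occur near it. -/
theorem Controlled.exists_settle {j k : ℕ} (hj : 4 ≤ j) (hk : 4 ≤ k) {x : Strand → ℕ → ℤ} {e : ℤ}
    (hx : Balanced j k x) (he : e = 1 ∨ e = -1)
    (hi : x Strand.inner 0 = e ∨ x Strand.inner 1 = e) (hq : Quiet j k x) {b : Bool}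
    (hs : ¬ Settled j k e b x) {t : Strand} (ht : t ≠ Strand.inner)
    (h1 : x t (endEdge j k b t) ≠ -e) (h2 : x t (nextEdge j k b t) ≠ -e)
    (hsafe : Safe j k e (!b) x) :
    ∃ t l g, CanDraw j k x t l g ∧ Controlled j k e (draw x t l g) := by
  have hns : ∀ t, t ≠ Strand.inner → x t (endEdge j k b t) ≠ e := by
    intro u hu hue
    exact hs ⟨u, hu, hue⟩
  have hz : x t (endEdge j k b t) = 0 := by
    have := hns t ht
    have := hx.sign t (endEdge j k b t)
    omega
  have hc : CanDraw j k x t (endEdge j k b t) e := by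
    apply hx.canDraw_end (by omega) (by omega) he hz h2
    cases t
    · exact ⟨Strand.lower, by simp, hns _ (by simp)⟩
    · exact absurd rfl ht
    · exact ⟨Strand.upper, by simp, hns _ (by simp)⟩
  refine ⟨t, _, e, hc, hc.ne, ?_, fun c => ?_, hc.quiet_draw ht hi hq⟩
  · exact hi.imp (hc.draw_eq hc.ne) (hc.draw_eq hc.ne)
  · by_cases hcb : c = b
    · subst hcb
      exact Or.inl ⟨t, ht, by simp [draw]⟩
    · have : c = !b := by cases c <;> cases b <;> simp_all
      exact this ▸ hsafe.draw hc

/-- The reply completes a cell if possible; otherwise it settles an unsettled junction, an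
endangered one first; if both are settled, it is the harmless move found by parity. -/
theorem Controlled.respond {j k : ℕ} (hj : 4 ≤ j) (hk : 4 ≤ k) {x : Strand → ℕ → ℤ} {e : ℤ}
    (he : e = 1 ∨ e = -1) (hx : Controlled j k e x) {s : Strand} {i : ℕ} {f : ℤ}
    (hm : CanDraw j k x s i f)
    (hodd : Odd (zeros j k (draw x s i f) Strand.upper + zeros j k (draw x s i f) Strand.inner +
      zeros j k (draw x s i f) Strand.lower)) :
    ∃ t l g, CanDraw j k (draw x s i f) t l g ∧ (HasCell j k (draw (draw x s i f) t l g) ∨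
      Controlled j k e (draw (draw x s i f) t l g)) := by
  have hor : (∀ b, Safe j k e b (draw x s i f)) ∨ ∃ b, Safe j k e (!b) (draw x s i f) ∧
      ¬ Settled j k e b (draw x s i f) ∧ ∃ t, t ≠ Strand.inner ∧
      draw x s i f t (endEdge j k b t) ≠ -e ∧ draw x s i f t (nextEdge j k b t) ≠ -e := by
    by_contra! hcon
    obtain ⟨⟨b, hb⟩, hcon⟩ := hcon
    unfold Safe at hb
    push Not at hb
    obtain ⟨hset, t, ht, hb⟩ := hb
    have hxb : ∀ t ≠ Strand.inner, x t (endEdge j k b t) ≠ -e ∧ x t (nextEdge j k b t) ≠ -e :=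
      (hx.safe b).resolve_left fun h => hset (h.draw hm hx.ne)
    have hts : s = t ∧ (i = endEdge j k b t ∨ i = nextEdge j k b t) := by
      have := hxb t ht
      unfold draw at hb
      grind
    obtain ⟨rfl, hib⟩ := hts
    have h4 := four_le_len hj hk ht
    -- Length at least four keeps the two pairs of edges near the junctions disjoint, so one move
    -- endangers only one junction; there the other outer path is still free of `-e`.
    have hfar : i ≠ endEdge j k (!b) s ∧ i ≠ nextEdge j k (!b) s := by
      unfold endEdge nextEdge at *
      cases b <;> simp_all <;> omega
    have hsafe : Safe j k e (!b) (draw x s i f) := by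
      rcases hx.safe (!b) with h | h
      · exact Or.inl (h.draw hm hx.ne)
      · right
        intro u hu
        have := h u hu
        unfold draw
        grind
    obtain ⟨u, hu, hus⟩ : ∃ u, u ≠ Strand.inner ∧ u ≠ s := by
      cases s
      · exact ⟨Strand.lower, by simp, by simp⟩
      · exact absurd rfl ht
      · exact ⟨Strand.upper, by simp, by simp⟩
    have h5 : draw x s i f u = x u := by
      funext n
      simp [draw, hus]
    have := hcon b hsafe hset u hu (by rw [h5]; exact (hxb u hu).1)
    rw [h5] at this
    exact (hxb u hu).2 this
  have hi := hx.inner.imp (hm.draw_eq hx.ne) (hm.draw_eq hx.ne)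
  by_cases hq : Quiet j k (draw x s i f)
  swap
  · unfold Quiet at hq
    push Not at hq
    obtain ⟨t, l, g, h1, h2⟩ := hq
    exact ⟨t, l, g, h1, Or.inl h2⟩
  have hb := hm.balanced
  suffices ∃ t l g, CanDraw j k (draw x s i f) t l g ∧
      Controlled j k e (draw (draw x s i f) t l g) by
    obtain ⟨t, l, g, h1, h2⟩ := this
    exact ⟨t, l, g, h1, Or.inr h2⟩
  generalize draw x s i f = y at *
  rcases hor with hsafe | ⟨b, hsafe, hset, t, ht, h1, h2⟩
  · by_cases hset : ∀ b, Settled j k e b y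
    · obtain ⟨t, l, g, h, hq'⟩ := hb.exists_quiet (by omega) (by omega) hq he hset hi hodd
      exact ⟨t, l, g, h, hx.ne, hi.imp (h.draw_eq hx.ne) (h.draw_eq hx.ne),
        fun b => Or.inl ((hset b).draw h hx.ne), hq'⟩
    · push Not at hset
      obtain ⟨b, hset⟩ := hset
      have h := (hsafe b).resolve_left hset Strand.upper (by simp)
      exact Controlled.exists_settle hj hk hb he hi hq hset (by simp) h.1 h.2 (hsafe _)
  · exact Controlled.exists_settle hj hk hb he hi hq hset ht h1 h2 hsafe

/-! ### Opening moves -/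

/-- The position of the winning player after his first move. -/
theorem Controlled.of_sign {j k : ℕ} {x : Strand → ℕ → ℤ} {e : ℤ}
    (he : e ≠ 0) (hx : ∀ s i, x s i = 0 ∨ x s i = e)
    (hi : x Strand.inner 0 = e ∨ x Strand.inner 1 = e)
    (hz : ∀ s ≠ Strand.inner, 1 < zeros j k x s + zeros j k x Strand.inner) :
    Controlled j k e x := by
  refine ⟨he, hi, fun b => Or.inr fun t _ => ?_, Quiet.of_zeros hz⟩
  have := hx t (endEdge j k b t)
  have := hx t (nextEdge j k b t)
  omega

theorem zeros_zero (j k : ℕ) (s : Strand) : zeros j k (fun _ _ => 0) s = len j k s := by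
  simp [zeros]

theorem CanDraw.of_sign {j k : ℕ} {x : Strand → ℕ → ℤ} {e : ℤ} (he : e = 1 ∨ e = -1)
    (hx : ∀ s i, x s i = 0 ∨ x s i = e) {s t : Strand} {i : ℕ} (hi : i < len j k s)
    (hz : x s i = 0) (hts : t ≠ s) (ht : ∀ l, x t l = 0) : CanDraw j k x s i e := by
  refine ⟨hi, by omega, hz, ⟨fun r n => ?_, fun r n _ => ?_, fun b f hf => ⟨t, ?_⟩⟩⟩
  · have := hx r n
    unfold draw
    grind
  · have := hx r n
    have := hx r (n + 1)
    unfold draw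
    grind
  · simpa [draw, hts, ht] using hf.symm

theorem exists_controlled {j k : ℕ} (hj : 4 ≤ j) (hk : 4 ≤ k) :
    ∃ t l g, CanDraw j k (fun _ _ => 0) t l g ∧ Controlled j k 1 (draw (fun _ _ => 0) t l g) := by
  have h : CanDraw j k (fun _ _ => 0) Strand.inner 0 1 :=
    CanDraw.of_sign (t := Strand.upper) (by simp) (by simp) (by simp [len]) rfl (by simp) (by simp)
  refine ⟨_, _, _, h, Controlled.of_sign (by simp) (fun s i => ?_) (by simp [draw]) ?_⟩
  · unfold draw
    split_ifs <;> simp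
  · intro s hs
    have := h.zeros_draw s
    rw [zeros_zero, if_neg hs] at this
    have := four_le_len hj hk hs
    omega

/-- As second player, take `e` to be the sign `f` of the opening move and copy it: on the inner
path, or on the upper path if the inner one was used. Then `-e` occurs nowhere. -/
theorem CanDraw.exists_controlled {j k : ℕ} (hj : 4 ≤ j) (hk : 4 ≤ k) {s : Strand} {i : ℕ} {f : ℤ}
    (h : CanDraw j k (fun _ _ => 0) s i f) :
    ∃ t l g, CanDraw j k (draw (fun _ _ => 0) s i f) t l g ∧
      Controlled j k f (draw (draw (fun _ _ => 0) s i f) t l g) := by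
  have hf : f = 1 ∨ f = -1 := by
    have := h.balanced.sign s i
    have := h.ne
    simp at this
    simp_all [draw]
  have hs1 : ∀ r n, draw (fun _ _ => 0) s i f r n = 0 ∨ draw (fun _ _ => 0) s i f r n = f := by
    intro r n
    unfold draw
    split_ifs <;> simp
  have hs2 : ∀ t l r n, draw (draw (fun _ _ => 0) s i f) t l f r n = 0 ∨
      draw (draw (fun _ _ => 0) s i f) t l f r n = f := by
    intro t l r n
    unfold draw
    split_ifs <;> simp
  have hz : ∀ {t l}, CanDraw j k (draw (fun _ _ => 0) s i f) t l f → ∀ r ≠ Strand.inner,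
      1 < zeros j k (draw (draw (fun _ _ => 0) s i f) t l f) r +
        zeros j k (draw (draw (fun _ _ => 0) s i f) t l f) Strand.inner := by
    intro t l h' r hr
    have h1 := h.zeros_draw r
    have h2 := h'.zeros_draw r
    rw [zeros_zero] at h1
    have := four_le_len hj hk hr
    have h3 := h.zeros_draw Strand.inner
    have h4 := h'.zeros_draw Strand.inner
    rw [zeros_zero] at h3
    simp only [len] at h3
    split_ifs at h1 h2 h3 h4 <;> omega
  by_cases hs : s = Strand.inner
  · subst hs
    have h' : CanDraw j k (draw (fun _ _ => 0) Strand.inner i f) Strand.upper 0 f :=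
      CanDraw.of_sign (t := Strand.lower) hf hs1 (by simp [len]; omega) (by simp [draw]) (by simp)
        (by simp [draw])
    have hlt := h.lt
    simp only [len] at hlt
    refine ⟨_, _, _, h', Controlled.of_sign h.ne (hs2 _ _) ?_ (hz h')⟩
    have : i = 0 ∨ i = 1 := by omega
    rcases this with rfl | rfl <;> simp [draw]
  · obtain ⟨t, ht, hts⟩ : ∃ t, t ≠ Strand.inner ∧ t ≠ s := by
      cases s
      · exact ⟨Strand.lower, by simp, by simp⟩
      · exact absurd rfl hs
      · exact ⟨Strand.upper, by simp, by simp⟩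
    have h' : CanDraw j k (draw (fun _ _ => 0) s i f) Strand.inner 0 f :=
      CanDraw.of_sign (t := t) hf hs1 (by simp [len]) (by simp [draw, Ne.symm hs]) ht
        (by simp [draw, hts])
    exact ⟨_, _, _, h', Controlled.of_sign h.ne (hs2 _ _) (by simp [draw]) (hz h')⟩

/-! ### Strategies from invariants -/

/-- A player wins if he can preserve an invariant of the positions in which the other one is to
move, until he creates a cycle cell. -/
theorem Board.hasWinningStrategy_of_invariant {V : Type} [Nonempty V] (B : Board V) (p : Player)
    (I : List (V × V) → Prop)
    (h0 : toMove ([] : List (V × V)) ≠ p → I [])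
    (h1 : toMove ([] : List (V × V)) = p → ∃ m, IsLegal B.graph (position []) m ∧ I [m])
    (hnil : ¬ B.HasCycleCell (position []))
    (step : ∀ h m, B.IsPlay (m :: h) → toMove h ≠ p → I h →
      ¬ B.HasCycleCell (position (m :: h)) ∧ ∃ m', IsLegal B.graph (position (m :: h)) m' ∧
        (B.HasCycleCell (position (m' :: m :: h)) ∨ I (m' :: m :: h))) :
    B.HasWinningStrategy p := by
  classical
  have alt : ∀ (m : V × V) (h : List (V × V)), toMove (m :: h) = p ↔ toMove h ≠ p := by
    intro m h
    rcases Nat.mod_two_eq_zero_or_one h.length with hl | hl <;> cases p <;>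
      simp [toMove, hl, Nat.add_mod]
  -- The default arrow is never used in a play that follows the strategy.
  let σ : List (V × V) → V × V := fun h =>
    if hh : ∃ m, IsLegal B.graph (position h) m ∧ (B.HasCycleCell (position (m :: h)) ∨ I (m :: h))
    then hh.choose else (Classical.arbitrary V, Classical.arbitrary V)
  have hσ : ∀ h, (∃ m, IsLegal B.graph (position h) m ∧
      (B.HasCycleCell (position (m :: h)) ∨ I (m :: h))) → IsLegal B.graph (position h) (σ h) ∧
      (B.HasCycleCell (position (σ h :: h)) ∨ I (σ h :: h)) := by
    intro h hh
    simp only [σ, dif_pos hh]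
    exact hh.choose_spec
  have key : ∀ h, B.IsPlay h → Follows σ p h →
      (toMove h ≠ p → B.HasCycleCell (position h) ∨ I h) ∧
      (toMove h = p → ¬ B.HasCycleCell (position h) ∧ ∃ m, IsLegal B.graph (position h) m ∧
        (B.HasCycleCell (position (m :: h)) ∨ I (m :: h))) := by
    intro h hp
    induction hp with
    | nil =>
      intro _
      refine ⟨fun h => Or.inr (h0 h), fun h => ⟨hnil, ?_⟩⟩
      obtain ⟨m, hm, hI⟩ := h1 h
      exact ⟨m, hm, Or.inr hI⟩
    | @cons h m hp hc hm ih =>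
      intro hf
      have ih := ih fun m' h' hs => hf m' h' (hs.trans (List.suffix_cons m h))
      refine ⟨fun ht => ?_, fun ht => ?_⟩
      · have ht' : toMove h = p := by
          by_contra hh
          exact ht ((alt m h).2 hh)
        rw [hf m h List.suffix_rfl ht']
        exact (hσ h (ih.2 ht').2).2
      · have ht' := (alt m h).1 ht
        exact step h m (Board.IsPlay.cons hp hc hm) ht' ((ih.1 ht').resolve_left hc)
  have hlast : ∀ h : List (V × V), toMove h ≠ p → lastMover h = p := by
    intro h ht
    rcases Nat.mod_two_eq_zero_or_one h.length with hl | hl <;> cases p <;>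
      simp_all [toMove, lastMover]
  refine ⟨σ, fun h hp hf => ⟨fun _ ht => (hσ h ((key h hp hf).2 ht).2).1, fun ho => ?_⟩⟩
  apply hlast
  intro ht
  obtain ⟨hc, m, hm, -⟩ := (key h hp hf).2 ht
  rcases ho with ho | ho
  · exact hc ho
  · exact ho m hm

/-! ### Positions as signings -/

/-- The arrow that gives edge `i` of path `s` the sign `1` (or else `-1`). -/
def arrow (j k : ℕ) (s : Strand) (i : ℕ) (f : ℤ) : Vertex j k × Vertex j k :=
  if f = 1 then (vertexAt j k s i, vertexAt j k s (i + 1))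
  else (vertexAt j k s (i + 1), vertexAt j k s i)

open Classical in
/-- The signs of the edges in a position. -/
noncomputable def signs (j k : ℕ) (P : Position (Vertex j k)) (s : Strand) (i : ℕ) : ℤ :=
  if i < len j k s ∧ (vertexAt j k s i, vertexAt j k s (i + 1)) ∈ P then 1
  else if i < len j k s ∧ (vertexAt j k s (i + 1), vertexAt j k s i) ∈ P then -1 else 0

/-- No edge is directed both ways. -/
def Oriented {V : Type} (P : Position V) : Prop := ∀ m ∈ P, m.swap ∉ P

section

variable {j k : ℕ} {P : Position (Vertex j k)}

theorem signs_eq_one_iff {s : Strand} {i : ℕ} (hi : i < len j k s) :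
    signs j k P s i = 1 ↔ (vertexAt j k s i, vertexAt j k s (i + 1)) ∈ P := by
  unfold signs
  split_ifs <;> simp_all

theorem signs_eq_neg_one_iff (hP : Oriented P) {s : Strand} {i : ℕ} (hi : i < len j k s) :
    signs j k P s i = -1 ↔ (vertexAt j k s (i + 1), vertexAt j k s i) ∈ P := by
  unfold signs
  have := hP (vertexAt j k s i, vertexAt j k s (i + 1))
  simp only [Prod.swap] at this
  split_ifs <;> simp_all

theorem signs_congr {Q : Position (Vertex j k)} {s : Strand} {i : ℕ}
    (h1 : (vertexAt j k s i, vertexAt j k s (i + 1)) ∈ P ↔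
      (vertexAt j k s i, vertexAt j k s (i + 1)) ∈ Q)
    (h2 : (vertexAt j k s (i + 1), vertexAt j k s i) ∈ P ↔
      (vertexAt j k s (i + 1), vertexAt j k s i) ∈ Q) : signs j k P s i = signs j k Q s i := by
  rw [signs, signs, propext h1, propext h2]

theorem signs_empty : signs j k ∅ = fun _ _ => 0 := by
  funext s i
  simp [signs]

theorem signs_insert (hj : 2 ≤ j) (hk : 2 ≤ k) {s : Strand} {i : ℕ} {f : ℤ} (hi : i < len j k s)
    (hf : f = 1 ∨ f = -1) (hz : signs j k P s i = 0) :
    signs j k (insert (arrow j k s i f) P) = draw (signs j k P) s i f := by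
  funext t l
  by_cases hl : l < len j k t
  swap
  · have : ¬ (t = s ∧ l = i) := by
      rintro ⟨rfl, rfl⟩
      exact hl hi
    simp [draw, signs, hl, this]
  have e1 := vertexAt_eq_iff hj hk t s l i hl.le hi.le
  have e2 := vertexAt_eq_iff hj hk t s (l + 1) i hl hi.le
  have e3 := vertexAt_eq_iff hj hk t s l (i + 1) hl.le hi
  have e4 := vertexAt_eq_iff hj hk t s (l + 1) (i + 1) hl hi
  have := two_le_len hj hk s
  have := two_le_len hj hk t
  by_cases h : t = s ∧ l = i
  · obtain ⟨rfl, rfl⟩ := h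
    have hn : vertexAt j k t l ≠ vertexAt j k t (l + 1) := by
      rw [Ne, e3]
      omega
    have hnf : (vertexAt j k t l, vertexAt j k t (l + 1)) ∉ P := fun h => by
      have := (signs_eq_one_iff hi).2 h
      omega
    rcases hf with rfl | rfl
    · simp [draw, signs, arrow, hi]
    · have hnf' : (vertexAt j k t l, vertexAt j k t (l + 1)) ∉ insert (arrow j k t l (-1)) P := by
        rintro (h | h)
        · exact hn (congrArg Prod.fst h)
        · exact hnf h
      have hb : (vertexAt j k t (l + 1), vertexAt j k t l) ∈ insert (arrow j k t l (-1)) P :=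
        Or.inl (by simp [arrow])
      simp [draw, signs, hi, hnf', hb]
  · have h1 : ∀ a, (vertexAt j k t l, vertexAt j k t (l + 1)) ≠ arrow j k s i a := by
      intro a
      unfold arrow
      split_ifs <;> rw [Ne, Prod.mk.injEq] <;> grind
    have h2 : ∀ a, (vertexAt j k t (l + 1), vertexAt j k t l) ≠ arrow j k s i a := by
      intro a
      unfold arrow
      split_ifs <;> rw [Ne, Prod.mk.injEq] <;> grind
    have m1 : (vertexAt j k t l, vertexAt j k t (l + 1)) ∈ insert (arrow j k s i f) P ↔
        (vertexAt j k t l, vertexAt j k t (l + 1)) ∈ P := or_iff_right (h1 f)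
    have m2 : (vertexAt j k t (l + 1), vertexAt j k t l) ∈ insert (arrow j k s i f) P ↔
        (vertexAt j k t (l + 1), vertexAt j k t l) ∈ P := or_iff_right (h2 f)
    rw [draw, if_neg h]
    exact signs_congr m1 m2

theorem exists_vertexAt (v : Vertex j k) :
    v = vertexAt j k Strand.inner 0 ∨ v = vertexAt j k Strand.inner 2 ∨
      ∃ s i, i + 1 < len j k s ∧ v = vertexAt j k s (i + 1) := by
  cases v with
  | left => left; simp [vertexAt]
  | right => right; left; simp [vertexAt, len]
  | mid s i pos lt =>
    right; right
    refine ⟨s, i - 1, by omega, ?_⟩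
    rw [Nat.sub_add_cancel pos]
    simp [vertexAt, pos, lt]

theorem vertexAt_zero (s : Strand) : vertexAt j k s 0 = Vertex.left := by simp [vertexAt]

theorem vertexAt_len (hj : 2 ≤ j) (hk : 2 ≤ k) (s : Strand) :
    vertexAt j k s (len j k s) = Vertex.right := by
  have := two_le_len hj hk s
  simp [vertexAt]
  omega

theorem adj_left_iff (hj : 2 ≤ j) (hk : 2 ≤ k) (w : Vertex j k) :
    (graph j k hj hk).Adj Vertex.left w ↔ ∃ t, w = vertexAt j k t 1 := by
  constructor
  · rintro ⟨s, i, hi, ⟨h1, h2⟩ | ⟨h1, h2⟩⟩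
    · rw [← vertexAt_zero s, vertexAt_eq_iff hj hk s s 0 i (by omega) hi.le] at h1
      have := two_le_len hj hk s
      obtain rfl : i = 0 := by omega
      exact ⟨s, h2⟩
    · rw [← vertexAt_zero s, vertexAt_eq_iff hj hk s s 0 (i + 1) (by omega) hi] at h2
      omega
  · rintro ⟨t, rfl⟩
    exact ⟨t, 0, by have := two_le_len hj hk t; omega, Or.inl ⟨(vertexAt_zero t).symm, rfl⟩⟩

theorem adj_right_iff (hj : 2 ≤ j) (hk : 2 ≤ k) (w : Vertex j k) :
    (graph j k hj hk).Adj Vertex.right w ↔ ∃ t, w = vertexAt j k t (len j k t - 1) := by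
  constructor
  · rintro ⟨s, i, hi, ⟨h1, h2⟩ | ⟨h1, h2⟩⟩
    · rw [← vertexAt_len hj hk s, vertexAt_eq_iff hj hk s s _ i le_rfl hi.le] at h1
      omega
    · rw [← vertexAt_len hj hk s, vertexAt_eq_iff hj hk s s _ (i + 1) le_rfl hi] at h2
      obtain rfl : i = len j k s - 1 := by omega
      exact ⟨s, h1⟩
  · rintro ⟨t, rfl⟩
    have := two_le_len hj hk t
    exact ⟨t, len j k t - 1, by omega, Or.inr ⟨rfl, by
      rw [Nat.sub_add_cancel (by omega), vertexAt_len hj hk]⟩⟩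

theorem adj_middle_iff (hj : 2 ≤ j) (hk : 2 ≤ k) {s : Strand} {i : ℕ} (hi : i + 1 < len j k s)
    (w : Vertex j k) : (graph j k hj hk).Adj (vertexAt j k s (i + 1)) w ↔
      w = vertexAt j k s i ∨ w = vertexAt j k s (i + 2) := by
  constructor
  · rintro ⟨t, l, hl, ⟨h1, h2⟩ | ⟨h1, h2⟩⟩
    · rw [vertexAt_eq_iff hj hk s t (i + 1) l hi.le hl.le] at h1
      obtain ⟨rfl, rfl⟩ : s = t ∧ i + 1 = l := by grind
      exact Or.inr h2
    · rw [vertexAt_eq_iff hj hk s t (i + 1) (l + 1) hi.le hl] at h2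
      obtain ⟨rfl, h3⟩ : s = t ∧ i + 1 = l + 1 := by grind
      obtain rfl : i = l := by omega
      exact Or.inl h1
  · rintro (rfl | rfl)
    · exact ⟨s, i, by omega, Or.inr ⟨rfl, rfl⟩⟩
    · exact ⟨s, i + 1, hi, Or.inl ⟨rfl, rfl⟩⟩

theorem signs_sign (s : Strand) (i : ℕ) :
    signs j k P s i = 0 ∨ signs j k P s i = 1 ∨ signs j k P s i = -1 := by
  unfold signs
  split_ifs <;> simp

/-- The two readings of "no sinks and no sources" agree. -/
theorem balanced_signs_iff (hj : 2 ≤ j) (hk : 2 ≤ k) (hP : Oriented P) :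
    (∀ v, ¬ IsSink (graph j k hj hk) P v ∧ ¬ IsSource (graph j k hj hk) P v) ↔
      Balanced j k (signs j k P) := by
  have h2 := two_le_len hj hk
  have hl : ∀ f, f = 1 ∨ f = -1 → ((∀ t, signs j k P t 0 = f) ↔
      if f = 1 then IsSource (graph j k hj hk) P Vertex.left
        else IsSink (graph j k hj hk) P Vertex.left) := by
    have hex : ∃ w, (graph j k hj hk).Adj Vertex.left w :=
      ⟨vertexAt j k Strand.inner 1, (adj_left_iff hj hk _).2 ⟨_, rfl⟩⟩
    rintro f (rfl | rfl)
    · rw [if_pos rfl, IsSource, and_iff_right hex]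
      simp only [adj_left_iff, forall_exists_index,
        forall_eq_apply_imp_iff]
      refine forall_congr' fun t => ?_
      rw [signs_eq_one_iff (by have := h2 t; omega), vertexAt_zero]
    · rw [if_neg (by norm_num), IsSink, and_iff_right hex]
      simp only [adj_left_iff,
        forall_exists_index, forall_eq_apply_imp_iff]
      refine forall_congr' fun t => ?_
      rw [signs_eq_neg_one_iff hP (by have := h2 t; omega), vertexAt_zero]
  have hr : ∀ f, f = 1 ∨ f = -1 → ((∀ t, signs j k P t (len j k t - 1) = f) ↔
      if f = 1 then IsSink (graph j k hj hk) P Vertex.right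
        else IsSource (graph j k hj hk) P Vertex.right) := by
    have hex : ∃ w, (graph j k hj hk).Adj Vertex.right w :=
      ⟨_, (adj_right_iff hj hk _).2 ⟨Strand.inner, rfl⟩⟩
    rintro f (rfl | rfl)
    · rw [if_pos rfl, IsSink, and_iff_right hex]
      simp only [adj_right_iff, forall_exists_index,
        forall_eq_apply_imp_iff]
      refine forall_congr' fun t => ?_
      have := h2 t
      rw [signs_eq_one_iff (by omega), Nat.sub_add_cancel (by omega), vertexAt_len hj hk]
    · rw [if_neg (by norm_num), IsSource, and_iff_right hex]
      simp only [adj_right_iff, forall_exists_index, forall_eq_apply_imp_iff]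
      refine forall_congr' fun t => ?_
      have := h2 t
      rw [signs_eq_neg_one_iff hP (by omega), Nat.sub_add_cancel (by omega), vertexAt_len hj hk]
  have hm : ∀ s i, i + 1 < len j k s →
      (IsSink (graph j k hj hk) P (vertexAt j k s (i + 1)) ↔
        signs j k P s i = 1 ∧ signs j k P s (i + 1) = -1) ∧
      (IsSource (graph j k hj hk) P (vertexAt j k s (i + 1)) ↔
        signs j k P s i = -1 ∧ signs j k P s (i + 1) = 1) := by
    intro s i hi
    have hex : ∃ w, (graph j k hj hk).Adj (vertexAt j k s (i + 1)) w :=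
      ⟨_, (adj_middle_iff hj hk hi _).2 (Or.inl rfl)⟩
    rw [signs_eq_one_iff (by omega), signs_eq_neg_one_iff hP hi, signs_eq_one_iff hi,
      signs_eq_neg_one_iff hP (by omega)]
    rw [IsSink, IsSource, and_iff_right hex, and_iff_right hex]
    simp only [adj_middle_iff hj hk hi, forall_eq_or_imp,
      forall_eq]
    simp
  constructor
  · intro h
    refine ⟨signs_sign, fun s i hi => ?_, fun b f hf => ?_⟩
    · have := h (vertexAt j k s (i + 1))
      rw [(hm s i hi).1, (hm s i hi).2] at this
      have := signs_sign (P := P) s i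
      have := signs_sign (P := P) s (i + 1)
      omega
    · by_contra! hcon
      have hf' : f = 1 ∨ f = -1 := by
        have := signs_sign (P := P) Strand.inner (endEdge j k b Strand.inner)
        rw [hcon] at this
        tauto
      cases b
      · have := (hl f hf').1 hcon
        have := h Vertex.left
        split_ifs at * <;> tauto
      · have := (hr f hf').1 hcon
        have := h Vertex.right
        split_ifs at * <;> tauto
  · intro h v
    rcases exists_vertexAt v with rfl | rfl | ⟨s, i, hi, rfl⟩
    · rw [vertexAt_zero]
      constructor
      · intro hs
        obtain ⟨t, ht⟩ := h.junction false (-1) (by norm_num)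
        exact ht ((hl (-1) (by simp)).2 (by simpa using hs) t)
      · intro hs
        obtain ⟨t, ht⟩ := h.junction false 1 (by norm_num)
        exact ht ((hl 1 (by simp)).2 (by simpa using hs) t)
    · rw [show vertexAt j k Strand.inner 2 = Vertex.right from vertexAt_len hj hk Strand.inner]
      constructor
      · intro hs
        obtain ⟨t, ht⟩ := h.junction true 1 (by norm_num)
        exact ht ((hr 1 (by simp)).2 (by simpa using hs) t)
      · intro hs
        obtain ⟨t, ht⟩ := h.junction true (-1) (by norm_num)
        exact ht ((hr (-1) (by simp)).2 (by simpa using hs) t)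
    · rw [(hm s i hi).1, (hm s i hi).2]
      have := h.path s i hi
      omega

theorem Oriented.insert {V : Type} {P : Position V} (hP : Oriented P) {m : V × V}
    (hne : m.1 ≠ m.2) (hm : m.swap ∉ P) : Oriented (insert m P) := by
  intro n hn hn'
  rcases hn with rfl | hn
  · rcases hn' with h | h
    · exact hne (congrArg Prod.snd h)
    · exact hm h
  · rcases hn' with h | h
    · apply hm
      rw [← h]
      simpa using hn
    · exact hP n hn h

theorem arrow_ne (hj : 2 ≤ j) (hk : 2 ≤ k) {s : Strand} {i : ℕ} (f : ℤ) (hi : i < len j k s) :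
    (arrow j k s i f).1 ≠ (arrow j k s i f).2 := by
  have := vertexAt_eq_iff hj hk s s i (i + 1) hi.le hi
  have := two_le_len hj hk s
  unfold arrow
  grind

theorem isLegal_arrow_iff (hj : 2 ≤ j) (hk : 2 ≤ k) (hP : Oriented P) {s : Strand} {i : ℕ} {f : ℤ}
    (hi : i < len j k s) (hf : f = 1 ∨ f = -1) :
    IsLegal (graph j k hj hk) P (arrow j k s i f) ↔ CanDraw j k (signs j k P) s i f := by
  have hadj : (graph j k hj hk).Adj (arrow j k s i f).1 (arrow j k s i f).2 := by
    refine ⟨s, i, hi, ?_⟩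
    unfold arrow
    split_ifs <;> simp
  have hz : (arrow j k s i f ∉ P ∧ (arrow j k s i f).swap ∉ P) ↔ signs j k P s i = 0 := by
    have h1 := signs_eq_one_iff (P := P) hi
    have h2 := signs_eq_neg_one_iff hP hi
    have h3 := signs_sign (P := P) s i
    unfold arrow
    rcases hf with rfl | rfl <;> simp only [Prod.swap] <;> norm_num <;> grind
  constructor
  · rintro ⟨-, h1, h2, h3⟩
    have h0 := hz.1 ⟨h1, h2⟩
    refine ⟨hi, by omega, h0, ?_⟩
    rw [← signs_insert hj hk hi hf h0]
    exact (balanced_signs_iff hj hk (hP.insert (arrow_ne hj hk f hi) h2)).1 h3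
  · rintro ⟨-, -, h0, h3⟩
    obtain ⟨h1, h2⟩ := hz.2 h0
    refine ⟨hadj, h1, h2, ?_⟩
    rw [← signs_insert hj hk hi hf h0] at h3
    exact (balanced_signs_iff hj hk (hP.insert (arrow_ne hj hk f hi) h2)).2 h3

theorem exists_arrow (hj : 2 ≤ j) (hk : 2 ≤ k) {m : Vertex j k × Vertex j k}
    (hm : (graph j k hj hk).Adj m.1 m.2) :
    ∃ s i f, i < len j k s ∧ (f = 1 ∨ f = -1) ∧ m = arrow j k s i f := by
  obtain ⟨s, i, hi, ⟨h1, h2⟩ | ⟨h1, h2⟩⟩ := hm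
  · exact ⟨s, i, 1, hi, by simp, Prod.ext (by simp [arrow, h1]) (by simp [arrow, h2])⟩
  · exact ⟨s, i, -1, hi, by simp, Prod.ext (by simp [arrow, h2]) (by simp [arrow, h1])⟩

end

/-! ### Cycle cells as signings -/

section

variable {j k : ℕ} {P : Position (Vertex j k)}

theorem polygon_isDirected_iff (hj : 2 ≤ j) (hk : 2 ≤ k) (hP : Oriented P) {s t : Strand}
    (hst : s ≠ t) : (polygon j k hj hk s t hst).IsDirected P ↔
      ∃ e, (e = 1 ∨ e = -1) ∧ (∀ i < len j k s, signs j k P s i = -e) ∧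
        ∀ i < len j k t, signs j k P t i = e := by
  have hs2 := two_le_len hj hk s
  have ht2 := two_le_len hj hk t
  have hv1 : ∀ i (hi : i < len j k s), (polygon j k hj hk s t hst).vert
      ⟨i, by simp only [polygon]; omega⟩ = vertexAt j k s i ∧
      (polygon j k hj hk s t hst).vert ((polygon j k hj hk s t hst).next
        ⟨i, by simp only [polygon]; omega⟩) = vertexAt j k s (i + 1) := by
    intro i hi
    constructor
    · simp [polygon, hi.le]
    · have : (i + 1) % (len j k s + len j k t) = i + 1 := Nat.mod_eq_of_lt (by omega)
      simp [polygon, ChordlessCycle.next, this, hi]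
  -- The polygon runs through `t` backwards, so edge `i` of `t` is its edge number `len j k s + len
  -- j k t - 1 - i`.
  have hv2 : ∀ i (hi : i < len j k t), (polygon j k hj hk s t hst).vert
      ⟨len j k s + len j k t - 1 - i, by simp only [polygon]; omega⟩ = vertexAt j k t (i + 1) ∧
      (polygon j k hj hk s t hst).vert ((polygon j k hj hk s t hst).next
        ⟨len j k s + len j k t - 1 - i, by simp only [polygon]; omega⟩) = vertexAt j k t i := by
    intro i hi
    constructor
    · simp only [polygon]
      split_ifs with h
      · rw [vertexAt_eq_iff hj hk _ _ _ _ h hi]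
        omega
      · congr 1
        omega
    · rcases Nat.eq_zero_or_pos i with rfl | h0
      · have : (len j k s + len j k t - 1 + 1) % (len j k s + len j k t) = 0 := by
          rw [show len j k s + len j k t - 1 + 1 = len j k s + len j k t by omega,
            Nat.mod_self]
        simp [polygon, ChordlessCycle.next, this, vertexAt_zero]
      · have : (len j k s + len j k t - 1 - i + 1) % (len j k s + len j k t) =
            len j k s + len j k t - i := by
          rw [show len j k s + len j k t - 1 - i + 1 = len j k s + len j k t - i by omega]
          exact Nat.mod_eq_of_lt (by omega)
        simp only [polygon, ChordlessCycle.next, this]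
        rw [if_neg (by omega)]
        congr 1
        omega
  have hall : ∀ Q : Vertex j k → Vertex j k → Prop,
      (∀ a, Q ((polygon j k hj hk s t hst).vert a)
        ((polygon j k hj hk s t hst).vert ((polygon j k hj hk s t hst).next a))) ↔
      (∀ i < len j k s, Q (vertexAt j k s i) (vertexAt j k s (i + 1))) ∧
      ∀ i < len j k t, Q (vertexAt j k t (i + 1)) (vertexAt j k t i) := by
    intro Q
    constructor
    · intro h
      constructor
      · intro i hi
        have := h ⟨i, by simp only [polygon]; omega⟩
        rwa [(hv1 i hi).1, (hv1 i hi).2] at this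
      · intro i hi
        have := h ⟨len j k s + len j k t - 1 - i, by simp only [polygon]; omega⟩
        rwa [(hv2 i hi).1, (hv2 i hi).2] at this
    · rintro ⟨h1, h2⟩ ⟨a, ha⟩
      have ha' : a < len j k s + len j k t := ha
      by_cases hi : a < len j k s
      · rw [(hv1 a hi).1, (hv1 a hi).2]
        exact h1 a hi
      · obtain ⟨i, hi', rfl⟩ : ∃ i, i < len j k t ∧ a = len j k s + len j k t - 1 - i :=
          ⟨len j k s + len j k t - 1 - a, by omega, by omega⟩
        rw [(hv2 i hi').1, (hv2 i hi').2]
        exact h2 i hi'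
  unfold ChordlessCycle.IsDirected
  rw [hall fun v w => (v, w) ∈ P, hall fun v w => (w, v) ∈ P]
  simp only [or_and_right, exists_or, exists_eq_left, neg_neg]
  -- The listed sense of rotation gives `s` sign `1` and `t` sign `-1`, which is the case `e = -1`.
  rw [or_comm]
  refine or_congr (and_congr ?_ ?_) (and_congr ?_ ?_) <;> refine forall₂_congr fun i hi => ?_ <;>
    first | rw [signs_eq_one_iff hi] | rw [signs_eq_neg_one_iff hP hi]

theorem hasCycleCell_iff (hj : 2 ≤ j) (hk : 2 ≤ k) (hP : Oriented P) :
    (board j k hj hk).HasCycleCell P ↔ HasCell j k (signs j k P) := by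
  have hne : ∀ e : ℤ, (e = 1 ∨ e = -1) → e ≠ 0 := by omega
  constructor
  · rintro ⟨c, rfl | rfl, hd⟩
    · obtain ⟨e, he, h1, h2⟩ := (polygon_isDirected_iff hj hk hP _).1 hd
      exact ⟨Strand.upper, by simp, e, hne e he, h1, h2⟩
    · obtain ⟨e, he, h1, h2⟩ := (polygon_isDirected_iff hj hk hP _).1 hd
      -- The lower polygon lists the inner path first, so the sign of the inner path is `-e`.
      exact ⟨Strand.lower, by simp, -e, by have := hne e he; omega, by simpa using h2, h1⟩
  · rintro ⟨s, hs, e, he, h1, h2⟩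
    have he' : e = 1 ∨ e = -1 := by
      have h3 := h2 0 (by simp [len])
      have := signs_sign (P := P) Strand.inner 0
      omega
    cases s
    · exact ⟨_, Or.inl rfl, (polygon_isDirected_iff hj hk hP _).2 ⟨e, he', h1, h2⟩⟩
    · exact absurd rfl hs
    · exact ⟨_, Or.inr rfl, (polygon_isDirected_iff hj hk hP _).2
        ⟨-e, by omega, by simpa using h2, h1⟩⟩

end

/-! ### Plays as signings, and the theorem -/

theorem position_cons {V : Type} (m : V × V) (h : List (V × V)) :
    position (m :: h) = insert m (position h) := by
  ext n
  simp [position]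

theorem position_nil {V : Type} : position ([] : List (V × V)) = ∅ := by
  simp [position]

theorem signs_nil (j k : ℕ) : signs j k (position []) = fun _ _ => 0 := by
  rw [position_nil, signs_empty]

/-- The invariant of plays: each move directs exactly one edge. -/
theorem Board.IsPlay.oriented_and_length {j k : ℕ} {hj : 2 ≤ j} {hk : 2 ≤ k}
    {h : List (Vertex j k × Vertex j k)} (hp : (board j k hj hk).IsPlay h) :
    Oriented (position h) ∧ h.length + (zeros j k (signs j k (position h)) Strand.upper +
      zeros j k (signs j k (position h)) Strand.inner +
      zeros j k (signs j k (position h)) Strand.lower) = j + 2 + k := by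
  induction hp with
  | nil =>
    refine ⟨?_, ?_⟩
    · simp [Oriented, position]
    · rw [signs_nil, zeros_zero, zeros_zero, zeros_zero]
      simp [len]
  | @cons h m _ _ hm ih =>
    obtain ⟨s, i, f, hi, hf, rfl⟩ := exists_arrow hj hk hm.1
    have hc := (isLegal_arrow_iff hj hk ih.1 hi hf).1 hm
    rw [position_cons, signs_insert hj hk hi hf hc.zero]
    refine ⟨ih.1.insert (arrow_ne hj hk f hi) hm.2.2.1, ?_⟩
    have h1 := hc.zeros_draw Strand.upper
    have h2 := hc.zeros_draw Strand.inner
    have h3 := hc.zeros_draw Strand.lower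
    have := ih.2
    simp only [List.length_cons]
    cases s <;> simp at h1 h2 h3 <;> omega

theorem Board.IsPlay.balanced {j k : ℕ} {hj : 2 ≤ j} {hk : 2 ≤ k}
    {h : List (Vertex j k × Vertex j k)} (hp : (board j k hj hk).IsPlay h) :
    Balanced j k (signs j k (position h)) := by
  cases hp with
  | nil =>
    rw [signs_nil]
    exact ⟨by simp, by simp, fun b f hf => ⟨Strand.inner, hf.symm⟩⟩
  | @cons h m hp' hc hm =>
    rw [← balanced_signs_iff hj hk (Board.IsPlay.cons hp' hc hm).oriented_and_length.1,
      position_cons]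
    exact hm.2.2.2

theorem CanDraw.sign {j k : ℕ} {x : Strand → ℕ → ℤ} {s : Strand} {i : ℕ} {f : ℤ}
    (h : CanDraw j k x s i f) : f = 1 ∨ f = -1 := by
  have h1 := h.balanced.sign s i
  have h2 := h.ne
  simp only [draw, and_self, if_true] at h1
  tauto

theorem hasWinningStrategy {j k : ℕ} (hj : 4 ≤ j) (hk : 4 ≤ k) (hj' : 2 ≤ j) (hk' : 2 ≤ k)
    (p : Player) (hp : toMove ([] : List (Vertex j k × Vertex j k)) = p ↔ Odd (j + k)) :
    (board j k hj' hk').HasWinningStrategy p := by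
  have : Nonempty (Vertex j k) := ⟨Vertex.left⟩
  have turn : ∀ h : List (Vertex j k × Vertex j k), toMove h ≠ p ↔ (h.length + (j + k)) % 2 = 0 := by
    intro h
    rcases Nat.mod_two_eq_zero_or_one h.length with hl | hl <;>
      rcases Nat.mod_two_eq_zero_or_one (j + k) with hl' | hl' <;> cases p <;>
      simp [toMove, hl, hl', Nat.add_mod _ (j + k), Nat.odd_iff] at hp ⊢
  have play : ∀ {P : Position (Vertex j k)} {s i f}, Oriented P → CanDraw j k (signs j k P) s i f →
      IsLegal (graph j k hj' hk') P (arrow j k s i f) ∧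
      Oriented (insert (arrow j k s i f) P) ∧
      signs j k (insert (arrow j k s i f) P) = draw (signs j k P) s i f := by
    intro P s i f hP hc
    have hl := (isLegal_arrow_iff hj' hk' hP hc.lt hc.sign).2 hc
    exact ⟨hl, hP.insert (arrow_ne hj' hk' f hc.lt) hl.2.2.1,
      signs_insert hj' hk' hc.lt hc.sign hc.zero⟩
  have hnil : Oriented (position ([] : List (Vertex j k × Vertex j k))) := by
    simp [Oriented, position]
  -- The empty play is a separate case, since `e` is only chosen once the opponent has opened.
  apply Board.hasWinningStrategy_of_invariant _ p fun h =>
    h = [] ∨ ∃ e, (e = 1 ∨ e = -1) ∧ Controlled j k e (signs j k (position h))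
  · exact fun _ => Or.inl rfl
  · intro _
    obtain ⟨t, l, g, hc, hI⟩ := exists_controlled hj hk
    rw [← signs_nil] at hc hI
    obtain ⟨h1, -, h3⟩ := play hnil hc
    refine ⟨_, h1, Or.inr ⟨1, by simp, ?_⟩⟩
    rw [position_cons, h3]
    exact hI
  · rw [hasCycleCell_iff hj' hk' hnil, signs_nil]
    rintro ⟨s, -, e, he, -, h⟩
    exact he (h 0 (by simp [len])).symm
  · intro h m hpl ht hI
    cases hpl with
    | cons hph hcell hm =>
    obtain ⟨s, i, f, hi, hf, rfl⟩ := exists_arrow hj' hk' hm.1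
    have hO := hph.oriented_and_length.1
    have hc := (isLegal_arrow_iff hj' hk' hO hi hf).1 hm
    obtain ⟨-, hO', hS⟩ := play hO hc
    have hpl := Board.IsPlay.cons hph hcell hm
    have hlen := hpl.oriented_and_length.2
    rw [← position_cons] at hO' hS
    have reply : ∀ {t l g}, CanDraw j k (draw (signs j k (position h)) s i f) t l g →
        IsLegal (graph j k hj' hk') (position (arrow j k s i f :: h)) (arrow j k t l g) ∧
        Oriented (position (arrow j k t l g :: arrow j k s i f :: h)) ∧
        signs j k (position (arrow j k t l g :: arrow j k s i f :: h)) =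
          draw (draw (signs j k (position h)) s i f) t l g := by
      intro t l g hc'
      rw [← hS] at hc' ⊢
      rw [position_cons (arrow j k t l g)]
      exact play hO' hc'
    rw [hasCycleCell_iff hj' hk' hO', hS]
    rcases hI with rfl | ⟨e, he, hI⟩
    · rw [signs_nil] at *
      constructor
      · apply HasCell.not_of_zeros
        intro r hr
        have h1 := hc.zeros_draw r
        rw [zeros_zero] at h1
        have := four_le_len hj hk hr
        split_ifs at h1 <;> omega
      · obtain ⟨t, l, g, hc', hI⟩ := hc.exists_controlled hj hk
        obtain ⟨h1, -, h3⟩ := reply hc'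
        refine ⟨_, h1, Or.inr (Or.inr ⟨f, hf, ?_⟩)⟩
        rw [h3]
        exact hI
    · refine ⟨hI.quiet s i f hc, ?_⟩
      -- Moves made plus undirected edges total `j + 2 + k`, so by `turn` an odd number of edges is
      -- undirected whenever the winning player has to reply.
      obtain ⟨t, l, g, hc', hI'⟩ := hI.respond hj hk he hc (by
        rw [hS] at hlen
        have := (turn h).1 ht
        simp only [List.length_cons] at hlen
        rw [Nat.odd_iff]
        omega)
      obtain ⟨h1, h2, h3⟩ := reply hc'
      refine ⟨_, h1, ?_⟩
      rw [hasCycleCell_iff hj' hk' h2, h3]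
      exact hI'.imp id fun hI' => Or.inr ⟨e, he, hI'⟩

end GameOfCycles

theorem mainTheorem4 (j k : ℕ) (hj : 4 ≤ j) (hk : 4 ≤ k) :
    (Odd (j + k) →
      (GameOfCycles.board j k (le_trans (by decide) hj) (le_trans (by decide) hk)).HasWinningStrategy
        GameOfCycles.Player.one) ∧
    (Even (j + k) →
      (GameOfCycles.board j k (le_trans (by decide) hj) (le_trans (by decide) hk)).HasWinningStrategy
        GameOfCycles.Player.two) := by
  refine ⟨fun h => ?_, fun h => ?_⟩
  · exact GameOfCycles.hasWinningStrategy hj hk _ _ _ (by simp [GameOfCycles.toMove, h])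
  · exact GameOfCycles.hasWinningStrategy hj hk _ _ _ (by simp [GameOfCycles.toMove, h])
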